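/- Let $r\ge 3$, let $S_r=\{a_1,\dots,a_r\}$, and let $M_r$ be the free monoid of words over $S_r$, with empty word $\epsilon$. Let $K$ be $\mathbb Z$, $\mathbb Q$, $\mathbb R$ or $\mathbb C$ with the usual absolute value (more generally, any nonzero normed commutative ring with $\|n x\|=n\|x\|$ for all $n\in\mathbb N$, $x\in K$). For a non-empty word $v$ let $\rho_v(w)$ be the number of (possibly overlapping) occurrences of $v$ in $w\in M_r$, and put $\rho_\epsilon(w)=|w|$. Let $\widehat C(M_r)$ be the $K$-module of finite $K$-linear combinations of the functions $\rho_v\colon M_r\to K$, modulo those combinations that are bounded functions on $M_r$. Below, $\rho_v$ also denotes its class in $\widehat C(M_r)$. Let $B=\{\rho_w : w\in M_r \text{ neither begins nor ends with } a_1\}$ (this includes $\rho_\epsilon$) and $$B_U=\{\rho_\epsilon\}\cup\{\rho_s : s\in S_r\setminus\{a_1\}\}\cup\{\rho_{s_1a_1^ks_2} : s_1,s_2\in S_r\setminus\{a_1\},\ k\ge 0\}\subset B .$$ Put $B_V=B\setminus B_U$, $U=\operatorname{span}_K B_U$ and $V=\operatorname{span}_K B_V$. For $k,m\ge 1$, letters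 $s_1,s_2\ne a_1$ and a non-empty word $v$ put $$\sigma_k^m(v)_{s_1s_2}=\sum_{0\le i<k,\ 0\le j<m}\rho_{s_1a_1^i\,v\,a_1^js_2}\in\widehat C(M_r).$$ Then: 1. The elements $\sigma_k^m(v)_{s_1s_2}$, where $k,m\ge 1$, $s_1,s_2\in S_r\setminus\{a_1\}$ and $v$ runs over the non-empty words whose first and last letters are both different from $a_1$, form a basis $B_V'$ of $V$ (with different parameters $(k,m,v,s_1,s_2)$ giving different basis elements). 2. The set $$B_U'=\{\rho_\epsilon\}\cup\{\rho_s : s\in S_r\setminus\{a_2\}\}\cup\{\rho_{s_1a_1^ks_2} : s_1,s_2\in S_r\setminus\{a_2\},\ k\ge 0\}$$ is a basis of $U$ (with different words giving different basis elements), and the disjoint union of $B_U'$ and $B_V'$ is a basis of $\widehat C(M_r)$. -/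

import Mathlib

namespace CountingFunctions

/-- Words over the alphabet `{a_1, …, a_r}`, i.e. elements of the free monoid `M_r`;
the empty word is `[]` and the product is concatenation. -/
abbrev Word (r : ℕ) : Type := List (Fin r)

/-- The number of (possibly overlapping) occurrences of `v` in `w`: the number of positions
`i < |w|` at which `v` starts. For `v = []` every position counts, which gives the
convention `ρ_ε(w) = |w|` (see `occ_nil`). -/
def occ {r : ℕ} (v w : Word r) : ℕ :=
  ((Finset.range w.length).filter (fun i => v <+: w.drop i)).card

theorem occ_nil {r : ℕ} (w : Word r) : occ [] w = w.length := by
  simp [occ]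

section Coefficients

variable (K : Type*) [NormedCommRing K]

/-- The elementary counting function `ρ_v`, with values in the coefficient ring `K`. -/
def rho {r : ℕ} (v : Word r) : Word r → K := fun w => (occ v w : K)

/-- The module of counting functions on `M_r`: all finite `K`-linear combinations of
elementary counting functions. -/
def countingFun (r : ℕ) : Submodule K (Word r → K) :=
  Submodule.span K (Set.range (fun v : Word r => rho K v))

/-- The module of all bounded functions on `M_r`. -/
def boundedFun (r : ℕ) : Submodule K (Word r → K) where
  carrier := {f | ∃ C : ℝ, ∀ w, ‖f w‖ ≤ C}
  zero_mem' := ⟨0, fun w => by simp⟩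
  add_mem' := by
    rintro f g ⟨C, hC⟩ ⟨D, hD⟩
    exact ⟨C + D, fun w => (norm_add_le _ _).trans (add_le_add (hC w) (hD w))⟩
  smul_mem' := by
    rintro c f ⟨C, hC⟩
    exact ⟨‖c‖ * C, fun w => (norm_mul_le _ _).trans
      (mul_le_mul_of_nonneg_left (hC w) (norm_nonneg c))⟩

/-- `Ĉ(M_r)`: counting functions modulo bounded counting functions. -/
abbrev CHat (r : ℕ) : Type _ :=
  (countingFun K r) ⧸ ((boundedFun K r).submoduleOf (countingFun K r))

/-- The class of `ρ_v` in `Ĉ(M_r)`. -/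
def rhoClass {r : ℕ} (v : Word r) : CHat K r :=
  Submodule.Quotient.mk ⟨rho K v, Submodule.subset_span ⟨v, rfl⟩⟩

/-- The standard basis `B` of `Ĉ(M_r)` for the letter `a`: the classes of `ρ_w`, where the word
`w` (possibly empty) neither begins nor ends with `a`. -/
def basisB {r : ℕ} (a : Fin r) : Set (CHat K r) :=
  {x | ∃ w : Word r, w.head? ≠ some a ∧ w.getLast? ≠ some a ∧ x = rhoClass K w}

end Coefficients

/-- The words `ε`, `s` and `s₁ a^k s₂` (`k ≥ 0`), with `s, s₁, s₂` letters different from `b`. -/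
def shortWords {r : ℕ} (a b : Fin r) : Set (Word r) :=
  {w | w = [] ∨ (∃ s, s ≠ b ∧ w = [s]) ∨
    ∃ (s₁ s₂ : Fin r) (k : ℕ), s₁ ≠ b ∧ s₂ ≠ b ∧ w = s₁ :: (List.replicate k a ++ [s₂])}

section Subspaces

variable (K : Type*) [NormedCommRing K] {r : ℕ}

/-- `B_U`: the classes of `ρ_ε`, `ρ_s` and `ρ_{s₁ a^k s₂}`, with `s, s₁, s₂ ≠ a`. -/
def basisBU (a : Fin r) : Set (CHat K r) := rhoClass K '' shortWords a a

/-- `B_V = B \ B_U`. -/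
def basisBV (a : Fin r) : Set (CHat K r) := basisB K a \ basisBU K a

/-- `U`, the span of `B_U`. -/
def subspaceU (a : Fin r) : Submodule K (CHat K r) := Submodule.span K (basisBU K a)

/-- `V`, the orthogonal complement of `U` with respect to the basis `B`, that is, the span
of `B_V`. -/
def subspaceV (a : Fin r) : Submodule K (CHat K r) := Submodule.span K (basisBV K a)

/-- `σ_k^m(v)_{s₁ s₂} = ∑_{i < k, j < m} ρ_{s₁ a^i v a^j s₂}` in `Ĉ(M_r)`. -/
def sigma (a : Fin r) (k m : ℕ) (v : Word r) (s₁ s₂ : Fin r) : CHat K r :=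
  ∑ i ∈ Finset.range k, ∑ j ∈ Finset.range m,
    rhoClass K ([s₁] ++ List.replicate i a ++ v ++ List.replicate j a ++ [s₂])

end Subspaces

/-- The parameters `(k, m, v, s₁, s₂)` of the sums `σ_k^m(v)_{s₁ s₂}` in `B_V'`. -/
@[ext]
structure SigmaIndex {r : ℕ} (a : Fin r) where
  k : ℕ
  m : ℕ
  v : Word r
  s₁ : Fin r
  s₂ : Fin r
  k_pos : 1 ≤ k
  m_pos : 1 ≤ m
  v_ne : v ≠ []
  v_first : v.head v_ne ≠ a
  v_last : v.getLast v_ne ≠ a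
  s₁_ne : s₁ ≠ a
  s₂_ne : s₂ ≠ a

section Families

variable (K : Type*) [NormedCommRing K] {r : ℕ}

/-- `B_V'`, as a family indexed by its parameters. -/
def familyBV' (a : Fin r) : SigmaIndex a → CHat K r :=
  fun p => sigma K a p.k p.m p.v p.s₁ p.s₂

/-- `B_U'`, as a family indexed by words: `ρ_ε`, `ρ_s` and `ρ_{s₁ a^k s₂}` with
`s, s₁, s₂ ≠ b`. -/
def familyBU' (a b : Fin r) : shortWords a b → CHat K r :=
  fun w => rhoClass K (w : Word r)

/-- The family `f` is a basis of the submodule `N`. -/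
def IsBasisOf {M ι : Type*} [AddCommGroup M] [Module K M] (f : ι → M)
    (N : Submodule K M) : Prop :=
  LinearIndependent K f ∧ Submodule.span K (Set.range f) = N

end Families

end CountingFunctions

/-! Up to a bounded error, every occurrence of `v` extends by one letter on either side, so `ρ_v = ∑
ρ_{sv} = ∑ ρ_{vs}` in `CHat`. Hence a chosen letter can be eliminated from both ends of a word, and
`B` spans (`span_basisB`). For independence (`linearIndepOn_rhoClass`), evaluate on `(w a^N)^n`:
long blocks separate occurrences, values grow linearly in `n`, and a bounded combination must vanish
on one block.

Both facts hold for every letter. So `B_U'` inherits independence from the standard basis for `a₂`,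
and the extension relations give it the same span as `B_U`. Each word of `B_V` is uniquely `s₁ a^i v
a^j s₂`; the `σ` are partial sums in `i` and in `j`, that is, two unitriangular changes of basis
(`IsBasisOf.partialSum`). Finally `U ⊕ V` is everything because `B_U` and `B_V` partition a basis.
-/

namespace CountingFunctions

/-! ### Combinatorics of occurrences in words. -/

section Occurrences

variable {r : ℕ}

theorem occ_cons (v : Word r) (b : Fin r) (w : Word r) :
    occ v (b :: w) = occ v w + if v <+: b :: w then 1 else 0 := by
  unfold occ
  rw [Finset.card_filter, Finset.card_filter, List.length_cons, Finset.sum_range_succ']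
  simp

theorem occ_empty (v : Word r) : occ v [] = 0 := by simp [occ]

theorem occ_eq_zero_of_length_lt {v w : Word r} (h : w.length < v.length) : occ v w = 0 := by
  induction w with
  | nil => exact occ_empty v
  | cons b w ih =>
    rw [List.length_cons] at h
    rw [occ_cons, ih (by omega), if_neg]
    intro hp
    have := hp.length_le
    rw [List.length_cons] at this
    omega

theorem occ_self {v : Word r} (hv : v ≠ []) : occ v v = 1 := by
  cases v with
  | nil => exact absurd rfl hv
  | cons b w => rw [occ_cons, occ_eq_zero_of_length_lt (by simp)]; simp

theorem occ_eq_zero_of_length_le {v w : Word r} (h : w.length ≤ v.length) (hne : v ≠ w) :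
    occ v w = 0 := by
  cases w with
  | nil => exact occ_empty v
  | cons b w =>
    rw [List.length_cons] at h
    rw [occ_cons, occ_eq_zero_of_length_lt (by omega), if_neg]
    exact fun hp => hne (hp.eq_of_length_le (by simpa using h))

theorem sum_prefix_cons (v : Word r) (b : Fin r) (w : Word r) :
    (∑ s : Fin r, if (s :: v) <+: b :: w then 1 else 0) = if v <+: w then 1 else 0 := by
  simp only [List.cons_prefix_cons, ite_and]
  simp

/-- Summing over all extensions to the left loses only an occurrence at the very beginning. -/
theorem occ_eq_sum_cons (v w : Word r) :
    occ v w + (if v = [] then 1 else 0) =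
      (∑ s : Fin r, occ (s :: v) w) + if v <+: w then 1 else 0 := by
  induction w with
  | nil => simp [occ_empty]
  | cons b w ih =>
    simp only [occ_cons, Finset.sum_add_distrib, sum_prefix_cons]
    omega

theorem sum_prefix_concat (v w : Word r) :
    (∑ s : Fin r, if (v ++ [s]) <+: w then 1 else 0) + (if v = w then 1 else 0) =
      if v <+: w then 1 else 0 := by
  induction v generalizing w with
  | nil =>
    cases w with
    | nil => simp
    | cons b w => simp [List.cons_prefix_cons]
  | cons c v ih =>
    cases w with
    | nil => simp
    | cons b w =>
      by_cases h : c = b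
      · subst h; simpa [List.cons_prefix_cons] using ih w
      · simp [List.cons_prefix_cons, h]

/-- Summing over all extensions to the right loses only an occurrence at the very end. -/
theorem occ_eq_sum_concat (v w : Word r) :
    occ v w = (∑ s : Fin r, occ (v ++ [s]) w) + if v ≠ [] ∧ v <:+ w then 1 else 0 := by
  induction w with
  | nil => simp [occ_empty]
  | cons b w ih =>
    simp only [occ_cons, Finset.sum_add_distrib]
    have h := sum_prefix_concat v (b :: w)
    have key : (if v ≠ [] ∧ v <:+ b :: w then 1 else 0) =
        (if v ≠ [] ∧ v <:+ w then 1 else 0) + if v = b :: w then 1 else 0 := by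
      by_cases h1 : v = b :: w
      · subst h1
        have : ¬ (b :: w) <:+ w := fun h => by simpa using h.length_le
        simp [this]
      · simp [List.suffix_cons_iff, h1]
    omega

theorem occ_replicate_append {v : Word r} {a : Fin r} (hv : v ≠ []) (h : v.head? ≠ some a)
    (N : ℕ) (x : Word r) : occ v (List.replicate N a ++ x) = occ v x := by
  induction N with
  | zero => simp
  | succ N ih =>
    have hp : ¬ v <+: a :: (List.replicate N a ++ x) := by
      cases v with
      | nil => exact absurd rfl hv
      | cons c v =>
        rw [List.cons_prefix_cons]
        rintro ⟨rfl, -⟩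
        exact h rfl
    rw [List.replicate_succ, List.cons_append, occ_cons, ih, if_neg hp, add_zero]

/-- A prefix `v` reaching beyond `w` would end inside the block, since `v.length ≤ N`, and so have
last letter `a`. -/
theorem prefix_append_replicate_append {v : Word r} {a : Fin r} (h : v.getLast? ≠ some a)
    {N : ℕ} (hN : v.length ≤ N) (w x : Word r) :
    v <+: w ++ (List.replicate N a ++ x) ↔ v <+: w := by
  refine ⟨fun hp => ?_, fun hp => hp.trans (List.prefix_append _ _)⟩
  rcases le_or_gt v.length w.length with hl | hl
  · exact List.prefix_of_prefix_length_le hp (List.prefix_append _ _) hl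
  · exfalso
    obtain ⟨t, rfl⟩ := List.prefix_of_prefix_length_le (List.prefix_append w _) hp hl.le
    rw [List.prefix_append_right_inj] at hp
    rw [List.length_append] at hN hl
    have ht : t <+: List.replicate N a :=
      List.prefix_of_prefix_length_le hp (List.prefix_append _ _) (by simp; omega)
    have hne : t ≠ [] := by rintro rfl; simp at hl
    have hlast : t.getLast hne = a := List.eq_of_mem_replicate (ht.subset (List.getLast_mem hne))
    apply h
    rw [List.getLast?_append_of_ne_nil _ hne, List.getLast?_eq_some_getLast hne, hlast]

/-- A long block of the letter `a` separates the occurrences of words which neither begin nor end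
with `a`. -/
theorem occ_append_replicate_append {v : Word r} {a : Fin r} (hv : v ≠ [])
    (h : v.head? ≠ some a) (h' : v.getLast? ≠ some a) {N : ℕ} (hN : v.length ≤ N)
    (w x : Word r) : occ v (w ++ (List.replicate N a ++ x)) = occ v w + occ v x := by
  induction w with
  | nil => simp [occ_replicate_append hv h, occ_empty]
  | cons b w ih =>
    have := prefix_append_replicate_append h' hN (b :: w) x
    rw [List.cons_append] at this
    rw [List.cons_append, occ_cons, occ_cons, ih]
    simp only [this]
    omega

/-- The word `(w a^N)^n`. -/
def blockPower (a : Fin r) (N : ℕ) (w : Word r) : ℕ → Word r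
  | 0 => []
  | n + 1 => w ++ (List.replicate N a ++ blockPower a N w n)

theorem occ_blockPower {v : Word r} {a : Fin r} (hv : v ≠ [])
    (h : v.head? ≠ some a) (h' : v.getLast? ≠ some a) {N : ℕ} (hN : v.length ≤ N)
    (w : Word r) (n : ℕ) : occ v (blockPower a N w n) = n * occ v w := by
  induction n with
  | zero => simp [blockPower, occ_empty]
  | succ n ih => rw [blockPower, occ_append_replicate_append hv h h' hN, ih]; ring

theorem occ_nil_blockPower (a : Fin r) (N : ℕ) (w : Word r) (n : ℕ) :
    occ [] (blockPower a N w n) = n * (w.length + N) := by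
  induction n with
  | zero => simp [blockPower, occ_empty]
  | succ n ih => rw [occ_nil] at *; simp [blockPower, ih]; ring

end Occurrences

/-! ### Extension relations modulo bounded functions. -/

section Relations

variable (K : Type*) [NormedCommRing K] {r : ℕ}

theorem sum_smul_rhoClass_eq_zero_iff {ι : Type*} (s : Finset ι) (c : ι → K) (v : ι → Word r) :
    ∑ i ∈ s, c i • rhoClass K (v i) = 0 ↔
      ∃ C : ℝ, ∀ w, ‖∑ i ∈ s, c i * (occ (v i) w : K)‖ ≤ C := by
  have h : ∑ i ∈ s, c i • rhoClass K (v i) =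
      Submodule.Quotient.mk (∑ i ∈ s, c i •
        (⟨rho K (v i), Submodule.subset_span ⟨v i, rfl⟩⟩ : countingFun K r)) := by
    simp only [rhoClass, ← Submodule.mkQ_apply, map_sum, map_smul]
  rw [h, Submodule.Quotient.mk_eq_zero, Submodule.submoduleOf, Submodule.mem_comap]
  refine exists_congr fun C => forall_congr' fun w => ?_
  simp [rho, Finset.sum_apply]

theorem rhoClass_eq_sum {ι : Type*} [Fintype ι] (v : Word r) (u : ι → Word r)
    (h : ∃ C : ℝ, ∀ w, ‖(occ v w : K) - ∑ i, (occ (u i) w : K)‖ ≤ C) :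
    rhoClass K v = ∑ i, rhoClass K (u i) := by
  have := (sum_smul_rhoClass_eq_zero_iff K (Finset.univ : Finset (Option ι))
    (fun o => o.elim 1 fun _ => -1) (fun o => o.elim v u)).2 (by
      simpa [Fintype.sum_option, ← sub_eq_add_neg] using h)
  rw [Fintype.sum_option] at this
  simpa [← sub_eq_add_neg, sub_eq_zero] using this

theorem rhoClass_eq_sum_cons (v : Word r) : rhoClass K v = ∑ s, rhoClass K (s :: v) := by
  -- The norm of `1` need not be `1` in `K`, so each indicator is bounded by `‖1‖`.
  refine rhoClass_eq_sum K v _ ⟨‖(1 : K)‖ + ‖(1 : K)‖, fun w => ?_⟩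
  have h := congrArg (Nat.cast : ℕ → K) (occ_eq_sum_cons v w)
  push_cast at h
  rw [show (occ v w : K) - ∑ i, (occ (i :: v) w : K) =
    (if v <+: w then 1 else 0) - (if v = [] then 1 else 0) by linear_combination h]
  refine (norm_sub_le _ _).trans (add_le_add ?_ ?_) <;> split_ifs <;> simp

theorem rhoClass_eq_sum_concat (v : Word r) : rhoClass K v = ∑ s, rhoClass K (v ++ [s]) := by
  refine rhoClass_eq_sum K v _ ⟨‖(1 : K)‖, fun w => ?_⟩
  have h := congrArg (Nat.cast : ℕ → K) (occ_eq_sum_concat v w)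
  push_cast at h
  rw [show (occ v w : K) - ∑ i, (occ (v ++ [i]) w : K) =
    (if v ≠ [] ∧ v <:+ w then 1 else 0) by linear_combination h]
  split_ifs <;> simp

variable {K}

theorem mem_of_sum_mem {M ι : Type*} [AddCommGroup M] [Module K M] [Fintype ι] [DecidableEq ι]
    {N : Submodule K M} {g : ι → M} (b : ι) (hsum : ∑ i, g i ∈ N) (h : ∀ i, i ≠ b → g i ∈ N) :
    g b ∈ N := by
  rw [← Finset.add_sum_erase _ _ (Finset.mem_univ b)] at hsum
  exact (N.add_mem_iff_left (N.sum_mem fun i hi => h i (Finset.ne_of_mem_erase hi))).1 hsum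

/-- Solves the left extension relation for the term `b :: v`; this is how the letter `b` is
eliminated from the front. -/
theorem rhoClass_cons_mem {N : Submodule K (CHat K r)} (b : Fin r) {v : Word r}
    (hv : rhoClass K v ∈ N) (h : ∀ s, s ≠ b → rhoClass K (s :: v) ∈ N) :
    rhoClass K (b :: v) ∈ N :=
  mem_of_sum_mem (g := fun s => rhoClass K (s :: v)) b (rhoClass_eq_sum_cons K v ▸ hv) h

theorem rhoClass_concat_mem {N : Submodule K (CHat K r)} (b : Fin r) {v : Word r}
    (hv : rhoClass K v ∈ N) (h : ∀ s, s ≠ b → rhoClass K (v ++ [s]) ∈ N) :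
    rhoClass K (v ++ [b]) ∈ N :=
  mem_of_sum_mem (g := fun s => rhoClass K (v ++ [s])) b (rhoClass_eq_sum_concat K v ▸ hv) h

end Relations

/-! ### The standard basis for an arbitrary letter. -/

section StandardBasis

variable {K : Type*} [NormedCommRing K] {r : ℕ}

/-- The words which neither begin nor end with `a`. -/
def innerWords (a : Fin r) : Set (Word r) := {w | w.head? ≠ some a ∧ w.getLast? ≠ some a}

theorem basisB_eq_image (a : Fin r) : basisB K a = rhoClass K '' innerWords a := by
  ext x
  simp only [basisB, innerWords, Set.mem_ofPred_eq, Set.mem_image, and_assoc, eq_comm]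

theorem span_range_rhoClass :
    Submodule.span K (Set.range (rhoClass K : Word r → CHat K r)) = ⊤ := by
  rw [eq_top_iff]
  rintro x -
  obtain ⟨⟨f, hf⟩, rfl⟩ := Submodule.Quotient.mk_surjective _ x
  induction hf using Submodule.span_induction with
  | mem f hf => obtain ⟨v, rfl⟩ := hf; exact Submodule.subset_span ⟨v, rfl⟩
  | zero => exact Submodule.zero_mem _
  | add f g hf hg h₁ h₂ => exact Submodule.add_mem _ h₁ h₂
  | smul c f hf h => exact Submodule.smul_mem _ c h

theorem span_basisB (a : Fin r) :
    Submodule.span K (rhoClass K '' innerWords a) = (⊤ : Submodule K (CHat K r)) := by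
  rw [eq_top_iff, ← span_range_rhoClass, Submodule.span_le]
  set N := Submodule.span K (rhoClass K '' innerWords a)
  -- The right end is cleared here, keeping the first letter different from `a`; the left end is
  -- cleared afterwards.
  have hN : ∀ w : Word r, w.head? ≠ some a → rhoClass K w ∈ N := by
    intro w
    induction w using List.reverseRecOn with
    | nil => exact fun _ => Submodule.subset_span ⟨[], by simp [innerWords], rfl⟩
    | append_singleton w b ih =>
      intro hw
      have hin : ∀ s, s ≠ a → rhoClass K (w ++ [s]) ∈ N := by
        refine fun s hs => Submodule.subset_span ⟨_, ⟨?_, by simpa using hs⟩, rfl⟩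
        cases w with
        | nil => simpa using hs
        | cons c w => simpa using hw
      by_cases hb : b = a
      · subst hb
        refine rhoClass_concat_mem b (ih ?_) hin
        cases w with
        | nil => simp
        | cons c w => simpa using hw
      · exact hin b hb
  rintro _ ⟨w, rfl⟩
  induction w with
  | nil => exact hN _ (by simp)
  | cons b w ih =>
    have hin : ∀ s, s ≠ a → rhoClass K (s :: w) ∈ N := fun s hs => hN _ (by simpa using hs)
    by_cases hb : b = a
    · subst hb; exact rhoClass_cons_mem b ih hin
    · exact hin b hb

theorem eq_zero_of_norm_nsmul_le (hK : ∀ (n : ℕ) (x : K), ‖n • x‖ = n * ‖x‖) {x : K} {C : ℝ}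
    (h : ∀ n : ℕ, ‖n • x‖ ≤ C) : x = 0 := by
  by_contra hx
  obtain ⟨n, hn⟩ := exists_nat_gt (C / ‖x‖)
  rw [div_lt_iff₀ (norm_pos_iff.2 hx), ← hK] at hn
  exact absurd (h n) (not_le.2 hn)

theorem linearIndepOn_rhoClass (hK : ∀ (n : ℕ) (x : K), ‖n • x‖ = n * ‖x‖) (a : Fin r) :
    LinearIndepOn K (rhoClass K) (innerWords a) := by
  rw [linearIndepOn_iff']
  intro s c hs h0
  obtain ⟨C, hC⟩ := (sum_smul_rhoClass_eq_zero_iff K s c id).1 h0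
  simp only [id] at hC
  obtain ⟨N₀, hN₀⟩ : ∃ N₀ : ℕ, ∀ v ∈ s, v.length ≤ N₀ :=
    ⟨s.sup List.length, fun v hv => Finset.le_sup (f := List.length) hv⟩
  -- On `(w a^N)^n` the combination equals `n` times this sum, so boundedness in `n` makes the sum
  -- zero. The empty word counts the whole block length.
  have key : ∀ w : Word r, ∀ N, N₀ ≤ N →
      ∑ v ∈ s, c v * ((if v = [] then w.length + N else occ v w : ℕ) : K) = 0 := by
    intro w N hN
    refine eq_zero_of_norm_nsmul_le hK (C := C) fun n => ?_
    convert hC (blockPower a N w n) using 2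
    rw [Finset.smul_sum]
    refine Finset.sum_congr rfl fun v hv => ?_
    split_ifs with hv0
    · subst hv0
      rw [occ_nil_blockPower]
      push_cast
      rw [nsmul_eq_mul]
      ring
    · rw [occ_blockPower hv0 (hs hv).1 (hs hv).2 ((hN₀ v hv).trans hN)]
      push_cast
      rw [nsmul_eq_mul]
      ring
  have hnil : ∀ v ∈ s, v = [] → c v = 0 := by
    rintro v hv rfl
    -- Pure blocks of `a` see only `ρ_ε`; the `+ 1` keeps the factor of `c []` nonzero.
    have h := key [] (N₀ + 1) (by omega)
    rw [Finset.sum_eq_single_of_mem [] hv] at h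
    · have h' := hK (N₀ + 1) (c [])
      rw [nsmul_eq_mul, mul_comm] at h'
      simp only [if_true, List.length_nil, zero_add] at h
      rw [h, norm_zero, eq_comm, mul_eq_zero] at h'
      rcases h' with h' | h'
      · exact absurd h' (by positivity)
      · exact norm_eq_zero.1 h'
    · intro v _ hv0
      simp [hv0, occ_empty]
  have hlen : ∀ n : ℕ, ∀ v ∈ s, v.length = n → c v = 0 := by
    intro n
    induction n using Nat.strong_induction_on with
    | _ n ih =>
      intro v hv hn
      by_cases hv0 : v = []
      · exact hnil v hv hv0
      -- Tested on `v` itself: shorter words have zero coefficient by induction, other words at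
      -- least as long do not occur in `v`.
      have h := key v N₀ le_rfl
      rw [Finset.sum_eq_single_of_mem v hv] at h
      · simpa [hv0, occ_self hv0] using h
      · intro u hu huv
        by_cases hu0 : u = []
        · rw [hnil u hu hu0, zero_mul]
        rcases lt_or_ge u.length v.length with hl | hl
        · rw [ih _ (hn ▸ hl) u hu rfl, zero_mul]
        · rw [if_neg hu0, occ_eq_zero_of_length_le hl huv, Nat.cast_zero, mul_zero]
  exact fun v hv => hlen _ v hv rfl

end StandardBasis

/-! ### The subspace `U` and its basis `B_U'`. -/

section ShortWords

variable {K : Type*} [NormedCommRing K] {r : ℕ}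

theorem shortWords_subset_innerWords (a b : Fin r) : shortWords a b ⊆ innerWords b := by
  rintro w (rfl | ⟨s, hs, rfl⟩ | ⟨s₁, s₂, k, h₁, h₂, rfl⟩)
  · simp [innerWords]
  · simp [innerWords, hs]
  · refine ⟨by simpa using h₁, ?_⟩
    rw [← List.cons_append, List.getLast?_concat]
    simpa using h₂

theorem rhoClass_mem_of_shortWords_self {a : Fin r} {N : Submodule K (CHat K r)}
    (h : ∀ w ∈ shortWords a a, rhoClass K w ∈ N) (b : Fin r) :
    ∀ w ∈ shortWords a b, rhoClass K w ∈ N := by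
  have hs : ∀ s, s ≠ a → rhoClass K [s] ∈ N := fun s hs => h _ (.inr (.inl ⟨s, hs, rfl⟩))
  have hss : ∀ s t k, s ≠ a → t ≠ a → rhoClass K (s :: (List.replicate k a ++ [t])) ∈ N :=
    fun s t k hs ht => h _ (.inr (.inr ⟨s, t, k, hs, ht, rfl⟩))
  have hr : ∀ k t, t ≠ a → rhoClass K (List.replicate k a ++ [t]) ∈ N := by
    intro k t ht
    induction k with
    | zero => exact hs t ht
    | succ k ih => exact rhoClass_cons_mem a ih fun s hs => hss s t k hs ht
  have hl : ∀ k s, s ≠ a → rhoClass K (s :: List.replicate k a) ∈ N := by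
    intro k s hsa
    induction k with
    | zero => exact hs s hsa
    | succ k ih =>
      rw [List.replicate_succ', ← List.cons_append]
      exact rhoClass_concat_mem a ih fun t ht => hss s t k hsa ht
  have ha : ∀ k, rhoClass K (List.replicate k a) ∈ N := by
    intro k
    induction k with
    | zero => exact h _ (.inl rfl)
    | succ k ih =>
      rw [List.replicate_succ']
      exact rhoClass_concat_mem a ih fun t ht => hr k t ht
  rintro w (rfl | ⟨s, -, rfl⟩ | ⟨s₁, s₂, k, -, -, rfl⟩)
  · exact ha 0
  · by_cases hsa : s = a
    · subst hsa; exact ha 1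
    · exact hs s hsa
  · by_cases h₁ : s₁ = a <;> by_cases h₂ : s₂ = a
    · subst h₁ h₂
      rw [← List.replicate_succ', ← List.replicate_succ]
      exact ha _
    · subst h₁
      exact hr (k + 1) s₂ h₂
    · subst h₂
      rw [← List.replicate_succ']
      exact hl _ s₁ h₁
    · exact hss s₁ s₂ k h₁ h₂

/-- As `a ≠ b`, the words `a^k`, `a^k t` and `s a^k` with `s, t ≠ b` are themselves generators, so
an end letter `b` can be removed by an extension relation, first on the left, then on the right. -/
theorem rhoClass_mem_of_shortWords {a b : Fin r} (hab : a ≠ b) {N : Submodule K (CHat K r)}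
    (h : ∀ w ∈ shortWords a b, rhoClass K w ∈ N) :
    ∀ w ∈ shortWords a a, rhoClass K w ∈ N := by
  have hs : ∀ s, s ≠ b → rhoClass K [s] ∈ N := fun s hs => h _ (.inr (.inl ⟨s, hs, rfl⟩))
  have hss : ∀ s t k, s ≠ b → t ≠ b → rhoClass K (s :: (List.replicate k a ++ [t])) ∈ N :=
    fun s t k hs ht => h _ (.inr (.inr ⟨s, t, k, hs, ht, rfl⟩))
  have ha : ∀ k, rhoClass K (List.replicate k a) ∈ N
    | 0 => h _ (.inl rfl)
    | 1 => hs a hab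
    | k + 2 => by
      rw [List.replicate_succ, List.replicate_succ']
      exact hss a a k hab hab
  have hr : ∀ k t, t ≠ b → rhoClass K (List.replicate k a ++ [t]) ∈ N
    | 0, t, ht => hs t ht
    | k + 1, t, ht => hss a t k hab ht
  have hl : ∀ k s, s ≠ b → rhoClass K (s :: List.replicate k a) ∈ N
    | 0, s, hsb => hs s hsb
    | k + 1, s, hsb => by rw [List.replicate_succ']; exact hss s a k hsb hab
  have hl' : ∀ k s, rhoClass K (s :: List.replicate k a) ∈ N := by
    intro k s
    by_cases hsb : s = b
    · subst hsb; exact rhoClass_cons_mem s (ha k) (hl k)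
    · exact hl k s hsb
  have hss' : ∀ s t k, t ≠ b → rhoClass K (s :: (List.replicate k a ++ [t])) ∈ N := by
    intro s t k ht
    by_cases hsb : s = b
    · subst hsb; exact rhoClass_cons_mem s (hr k t ht) fun u hu => hss u t k hu ht
    · exact hss s t k hsb ht
  have hss'' : ∀ s t k, rhoClass K (s :: (List.replicate k a ++ [t])) ∈ N := by
    intro s t k
    by_cases htb : t = b
    · subst htb
      rw [← List.cons_append]
      exact rhoClass_concat_mem t (hl' k s) fun u hu => hss' s u k hu
    · exact hss' s t k htb
  rintro w (rfl | ⟨s, -, rfl⟩ | ⟨s₁, s₂, k, -, -, rfl⟩)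
  · exact ha 0
  · exact hl' 0 s
  · exact hss'' s₁ s₂ k

theorem isBasisOf_familyBU' (hK : ∀ (n : ℕ) (x : K), ‖n • x‖ = n * ‖x‖) {a b : Fin r}
    (hab : a ≠ b) : IsBasisOf K (familyBU' K a b) (subspaceU K a) := by
  refine ⟨(linearIndepOn_rhoClass hK b).mono (shortWords_subset_innerWords a b), ?_⟩
  apply le_antisymm
  · rw [Submodule.span_le]
    rintro _ ⟨⟨w, hw⟩, rfl⟩
    exact rhoClass_mem_of_shortWords_self
      (fun w hw => Submodule.subset_span (Set.mem_image_of_mem _ hw)) b w hw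
  · rw [subspaceU, Submodule.span_le]
    rintro _ ⟨w, hw, rfl⟩
    exact rhoClass_mem_of_shortWords hab
      (fun w hw => Submodule.subset_span (Set.mem_range_self (⟨w, hw⟩ : shortWords a b))) w hw

end ShortWords

/-! ### Partial sums as a change of basis. -/

section PartialSums

variable {K : Type*} [NormedCommRing K] {M ι κ : Type*} [AddCommGroup M] [Module K M]

theorem IsBasisOf.comp_equiv {f : ι → M} {N : Submodule K M} (h : IsBasisOf K f N)
    (e : κ ≃ ι) : IsBasisOf K (fun i => f (e i)) N :=
  ⟨h.1.comp e e.injective, by rw [← h.2]; congr 1; exact e.surjective.range_comp f⟩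

theorem linearIndependent_sum_range_single :
    LinearIndependent K (fun p : ℕ × ι =>
      ∑ i ∈ Finset.range (p.1 + 1), Finsupp.single (i, p.2) (1 : K)) := by
  -- `D` is the difference operator in the first index; it telescopes partial sums back to the
  -- standard basis.
  obtain ⟨D, hD₀, hD₁⟩ : ∃ D : (ℕ × ι →₀ K) →ₗ[K] (ℕ × ι →₀ K),
      (∀ i, D (Finsupp.single (0, i) 1) = Finsupp.single (0, i) 1) ∧
      ∀ n i, D (Finsupp.single (n + 1, i) 1) =
        Finsupp.single (n + 1, i) 1 - Finsupp.single (n, i) 1 := by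
    refine ⟨Finsupp.linearCombination K fun p => Nat.casesOn p.1 (Finsupp.single (0, p.2) 1)
      fun n => Finsupp.single (n + 1, p.2) 1 - Finsupp.single (n, p.2) 1, fun i => ?_,
      fun n i => ?_⟩ <;> exact (Finsupp.linearCombination_single _ _ _).trans (one_smul _ _)
  have hD : ∀ n i, D (∑ j ∈ Finset.range (n + 1), Finsupp.single (j, i) 1) =
      Finsupp.single (n, i) 1 := by
    intro n i
    induction n with
    | zero => rw [zero_add, Finset.sum_range_one, hD₀]
    | succ n ih => rw [Finset.sum_range_succ, map_add, ih, hD₁, add_sub_cancel]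
  refine LinearIndependent.of_comp D ?_
  have h : (D ∘ fun p : ℕ × ι => ∑ i ∈ Finset.range (p.1 + 1), Finsupp.single (i, p.2) (1 : K)) =
      fun p => Finsupp.single p 1 := funext fun p => hD p.1 p.2
  rw [h]
  exact Finsupp.linearIndependent_single_one K (ℕ × ι)

theorem IsBasisOf.partialSum {f : ℕ × ι → M} {N : Submodule K M} (h : IsBasisOf K f N) :
    IsBasisOf K (fun p : ℕ × ι => ∑ i ∈ Finset.range (p.1 + 1), f (i, p.2)) N := by
  refine ⟨?_, ?_⟩
  · have key := (linearIndependent_sum_range_single (K := K) (ι := ι)).map'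
      (Finsupp.linearCombination K f) (LinearMap.ker_eq_bot.2 h.1)
    simpa only [Function.comp_def, map_sum, Finsupp.linearCombination_single, one_smul]
      using key
  · rw [← h.2]
    apply le_antisymm <;> rw [Submodule.span_le]
    · rintro _ ⟨p, rfl⟩
      exact Submodule.sum_mem _ fun i _ => Submodule.subset_span ⟨_, rfl⟩
    · rintro _ ⟨⟨n, i⟩, rfl⟩
      cases n with
      | zero => exact Submodule.subset_span ⟨(0, i), by simp⟩
      | succ n =>
        have := Submodule.sub_mem _
          (Submodule.subset_span (R := K) (Set.mem_range_self (f := fun p : ℕ × ι =>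
            ∑ i ∈ Finset.range (p.1 + 1), f (i, p.2)) (n + 1, i)))
          (Submodule.subset_span (Set.mem_range_self (n, i)))
        simpa [Finset.sum_range_succ _ (n + 1)] using this

end PartialSums

/-! ### The subspace `V` and its basis `B_V'`. -/

section LongWords

variable {K : Type*} [NormedCommRing K] {r : ℕ}

theorem exists_eq_replicate_append (a : Fin r) (u : Word r) :
    ∃ i x, u = List.replicate i a ++ x ∧ x.head? ≠ some a := by
  induction u with
  | nil => exact ⟨0, [], by simp⟩
  | cons b u ih =>
    by_cases hb : b = a
    · obtain ⟨i, x, rfl, hx⟩ := ih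
      exact ⟨i + 1, x, by simp [List.replicate_succ, hb], hx⟩
    · exact ⟨0, b :: u, by simp, by simpa using hb⟩

theorem exists_eq_append_replicate (a : Fin r) (u : Word r) :
    ∃ j x, u = x ++ List.replicate j a ∧ x.getLast? ≠ some a := by
  obtain ⟨j, x, hu, hx⟩ := exists_eq_replicate_append a u.reverse
  refine ⟨j, x.reverse, ?_, by simpa using hx⟩
  rw [← List.reverse_reverse u, hu]
  simp

theorem replicate_append_inj {a : Fin r} {i j : ℕ} {x y : Word r} (hx : x.head? ≠ some a)
    (hy : y.head? ≠ some a) (h : List.replicate i a ++ x = List.replicate j a ++ y) :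
    i = j ∧ x = y := by
  induction i generalizing j with
  | zero =>
    cases j with
    | zero => exact ⟨rfl, by simpa using h⟩
    | succ j => exact absurd (by simpa [List.replicate_succ] using congrArg List.head? h) hx
  | succ i ih =>
    cases j with
    | zero =>
      exact absurd (by simpa [List.replicate_succ] using (congrArg List.head? h).symm) hy
    | succ j =>
      simp only [List.replicate_succ, List.cons_append, List.cons.injEq, true_and] at h
      obtain ⟨rfl, rfl⟩ := ih h
      exact ⟨rfl, rfl⟩

theorem append_replicate_inj {a : Fin r} {i j : ℕ} {x y : Word r} (hx : x.getLast? ≠ some a)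
    (hy : y.getLast? ≠ some a) (h : x ++ List.replicate i a = y ++ List.replicate j a) :
    i = j ∧ x = y := by
  have := replicate_append_inj (a := a) (i := i) (j := j) (x := x.reverse) (y := y.reverse)
    (by simpa using hx) (by simpa using hy) (by simpa using congrArg List.reverse h)
  simpa using this

/-- The word `s₁ a^(k-1) v a^(m-1) s₂`. -/
def SigmaIndex.word {a : Fin r} (p : SigmaIndex a) : Word r :=
  [p.s₁] ++ List.replicate (p.k - 1) a ++ p.v ++ List.replicate (p.m - 1) a ++ [p.s₂]

theorem SigmaIndex.head?_v {a : Fin r} (p : SigmaIndex a) : p.v.head? ≠ some a := by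
  rw [List.head?_eq_some_head p.v_ne]
  simpa using p.v_first

theorem SigmaIndex.getLast?_v {a : Fin r} (p : SigmaIndex a) : p.v.getLast? ≠ some a := by
  rw [List.getLast?_eq_some_getLast p.v_ne]
  simpa using p.v_last

/-- Since `v` neither begins nor ends with `a`, the two blocks of `a` around it are maximal and
hence determined by the word. -/
theorem SigmaIndex.word_injective (a : Fin r) :
    Function.Injective (SigmaIndex.word : SigmaIndex a → Word r) := by
  intro p q h
  have hk := p.k_pos
  have hk' := q.k_pos
  have hm := p.m_pos
  have hm' := q.m_pos
  obtain ⟨h, h₂⟩ := List.append_inj' h rfl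
  simp only [List.append_assoc] at h
  obtain ⟨h₁, h⟩ := List.append_inj h rfl
  obtain ⟨h₃, h⟩ := replicate_append_inj
    (by rw [List.head?_append_of_ne_nil _ p.v_ne]; exact p.head?_v)
    (by rw [List.head?_append_of_ne_nil _ q.v_ne]; exact q.head?_v) h
  obtain ⟨h₄, h⟩ := append_replicate_inj p.getLast?_v q.getLast?_v h
  exact SigmaIndex.ext (by omega) (by omega) h (by simpa using h₁) (by simpa using h₂)

theorem SigmaIndex.range_word (a : Fin r) :
    Set.range (SigmaIndex.word : SigmaIndex a → Word r) = innerWords a \ shortWords a a := by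
  ext w
  constructor
  · rintro ⟨p, rfl⟩
    refine ⟨⟨by simpa [SigmaIndex.word] using p.s₁_ne, ?_⟩, ?_⟩
    · rw [SigmaIndex.word, List.getLast?_concat]
      simpa using p.s₂_ne
    · rintro (h | ⟨s, -, h⟩ | ⟨s₁, s₂, k, -, -, h⟩)
      · simpa [SigmaIndex.word] using congrArg List.length h
      · have h' := congrArg List.length h
        simp [SigmaIndex.word] at h'
      · rw [← List.cons_append] at h
        obtain ⟨h, -⟩ := List.append_inj' h rfl
        simp only [List.append_assoc, List.cons_append, List.nil_append, List.cons.injEq] at h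
        have hmem : p.v.head p.v_ne ∈ List.replicate k a := by
          rw [← h.2]
          simp [List.head_mem]
        exact p.v_first (List.eq_of_mem_replicate hmem)
  · rintro ⟨⟨h₁, h₂⟩, hs⟩
    cases w with
    | nil => exact absurd (.inl rfl) hs
    | cons s₁ w =>
      have hs₁ : s₁ ≠ a := by simpa using h₁
      rcases List.eq_nil_or_concat w with rfl | ⟨u, s₂, rfl⟩
      · exact absurd (.inr (.inl ⟨s₁, hs₁, rfl⟩)) hs
      · rw [List.concat_eq_append] at h₂ hs ⊢
        rw [← List.cons_append, List.getLast?_concat] at h₂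
        have hs₂ : s₂ ≠ a := by simpa using h₂
        obtain ⟨i, x, rfl, hx⟩ := exists_eq_replicate_append a u
        obtain ⟨j, v, rfl, hv⟩ := exists_eq_append_replicate a x
        -- If stripping `a` from both ends of the middle left nothing, the word would be short.
        have hne : v ≠ [] := by
          rintro rfl
          refine hs (.inr (.inr ⟨s₁, s₂, i + j, hs₁, hs₂, ?_⟩))
          simp
        rw [List.head?_append_of_ne_nil _ hne, List.head?_eq_some_head hne] at hx
        rw [List.getLast?_eq_some_getLast hne] at hv
        exact ⟨⟨i + 1, j + 1, v, s₁, s₂, by omega, by omega, hne, by simpa using hx,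
          by simpa using hv, hs₁, hs₂⟩, by simp [SigmaIndex.word]⟩

variable (K)

theorem basisBV_eq_image (hK : ∀ (n : ℕ) (x : K), ‖n • x‖ = n * ‖x‖) [Nontrivial K]
    (a : Fin r) : basisBV K a = rhoClass K '' (innerWords a \ shortWords a a) := by
  rw [basisBV, basisB_eq_image, basisBU,
    (linearIndepOn_rhoClass hK a).injOn.image_sdiff_subset (shortWords_subset_innerWords a a)]

theorem isBasisOf_rhoClass_word (hK : ∀ (n : ℕ) (x : K), ‖n • x‖ = n * ‖x‖) [Nontrivial K]
    (a : Fin r) : IsBasisOf K (fun p : SigmaIndex a => rhoClass K p.word) (subspaceV K a) := by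
  constructor
  · exact (linearIndepOn_rhoClass hK a).comp
      (fun p : SigmaIndex a => ⟨p.word, ((SigmaIndex.range_word a).le ⟨p, rfl⟩).1⟩)
      fun p q h => SigmaIndex.word_injective a (congrArg Subtype.val h)
  · rw [subspaceV, basisBV_eq_image K hK, ← SigmaIndex.range_word, ← Set.range_comp]
    rfl

/-- Separating the exponents `(k, m)`, shifted to start at `0`, from the remaining parameters,
represented by those with `k = m = 1`. -/
def SigmaIndex.equivProd (a : Fin r) :
    SigmaIndex a ≃ ℕ × ℕ × {p : SigmaIndex a // p.k = 1 ∧ p.m = 1} where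
  toFun p := (p.k - 1, p.m - 1, ⟨{ p with k := 1, m := 1, k_pos := le_rfl, m_pos := le_rfl },
    rfl, rfl⟩)
  invFun q := { q.2.2.1 with
    k := q.1 + 1, m := q.2.1 + 1, k_pos := Nat.le_add_left _ _, m_pos := Nat.le_add_left _ _ }
  left_inv p := by
    have := p.k_pos
    have := p.m_pos
    ext1 <;> simp <;> omega
  right_inv := by
    rintro ⟨k, m, ⟨p, hk, hm⟩⟩
    refine Prod.ext rfl (Prod.ext rfl (Subtype.ext ?_))
    exact SigmaIndex.ext hk.symm hm.symm rfl rfl rfl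

theorem isBasisOf_familyBV' (hK : ∀ (n : ℕ) (x : K), ‖n • x‖ = n * ‖x‖) [Nontrivial K]
    (a : Fin r) : IsBasisOf K (familyBV' K a) (subspaceV K a) := by
  let ι := {p : SigmaIndex a // p.k = 1 ∧ p.m = 1}
  -- `IsBasisOf.partialSum` sums over the first coordinate only, so the exponents are swapped to sum
  -- over the second, then swapped back.
  let swap : ℕ × ℕ × ι ≃ ℕ × ℕ × ι :=
    ⟨fun q => (q.2.1, q.1, q.2.2), fun q => (q.2.1, q.1, q.2.2), fun _ => rfl, fun _ => rfl⟩
  have h := ((((isBasisOf_rhoClass_word K hK a).comp_equiv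
    (SigmaIndex.equivProd a).symm).partialSum.comp_equiv swap).partialSum.comp_equiv
      swap).comp_equiv (SigmaIndex.equivProd a)
  convert h using 1
  ext1 p
  have hk := Nat.sub_add_cancel p.k_pos
  have hm := Nat.sub_add_cancel p.m_pos
  simp only [familyBV', sigma, SigmaIndex.equivProd, swap, Equiv.coe_fn_mk, Equiv.coe_fn_symm_mk,
    SigmaIndex.word, hk, hm, Nat.add_sub_cancel]
  exact Finset.sum_comm

end LongWords

/-! ### The decomposition into `U` and `V`. -/

section Sum

variable {K : Type*} [NormedCommRing K] {r : ℕ}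

theorem isCompl_subspaceU_subspaceV (hK : ∀ (n : ℕ) (x : K), ‖n • x‖ = n * ‖x‖) [Nontrivial K]
    (a : Fin r) : IsCompl (subspaceU K a) (subspaceV K a) := by
  have hsub := shortWords_subset_innerWords a a
  rw [subspaceU, subspaceV, basisBV_eq_image K hK, basisBU]
  constructor
  · have h := (linearIndepOn_rhoClass hK a).disjoint_span_image
      (s := Subtype.val ⁻¹' shortWords a a) (t := (Subtype.val ⁻¹' shortWords a a)ᶜ)
      disjoint_compl_right
    have himage : ∀ t : Set (Word r), (fun w : innerWords a => rhoClass K (w : Word r)) ''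
        (Subtype.val ⁻¹' t) = rhoClass K '' (innerWords a ∩ t) := fun t => by
      rw [← Subtype.image_preimage_coe, Set.image_image]
    rwa [← Set.preimage_compl, himage, himage, Set.inter_eq_self_of_subset_right hsub,
      ← Set.sdiff_eq] at h
  · rw [codisjoint_iff, ← Submodule.span_union, ← Set.image_union, Set.union_sdiff_cancel hsub,
      span_basisB]

theorem IsBasisOf.sumElim {M ι κ : Type*} [AddCommGroup M] [Module K M] {f : ι → M} {g : κ → M}
    {N P : Submodule K M} (hf : IsBasisOf K f N) (hg : IsBasisOf K g P) (h : IsCompl N P) :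
    IsBasisOf K (Sum.elim f g) ⊤ := by
  refine ⟨hf.1.sum_type hg.1 (by rw [hf.2, hg.2]; exact h.disjoint), ?_⟩
  rw [Set.Sum.elim_range, Submodule.span_union, hf.2, hg.2, h.sup_eq_top]

end Sum

end CountingFunctions

theorem proposition3p4 {K : Type*} [NormedCommRing K] [Nontrivial K]
    (hK : ∀ (n : ℕ) (x : K), ‖n • x‖ = n * ‖x‖)
    {r : ℕ} (hr : 3 ≤ r) (a₁ a₂ : Fin r) (ha : a₁ ≠ a₂) :
    CountingFunctions.IsBasisOf K (CountingFunctions.familyBV' K a₁)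
        (CountingFunctions.subspaceV K a₁) ∧
      CountingFunctions.IsBasisOf K (CountingFunctions.familyBU' K a₁ a₂)
        (CountingFunctions.subspaceU K a₁) ∧
      CountingFunctions.IsBasisOf K
        (Sum.elim (CountingFunctions.familyBU' K a₁ a₂) (CountingFunctions.familyBV' K a₁))
        (⊤ : Submodule K (CountingFunctions.CHat K r)) := by
  have hV := CountingFunctions.isBasisOf_familyBV' K hK a₁
  have hU := CountingFunctions.isBasisOf_familyBU' hK ha
  exact ⟨hV, hU, hU.sumElim hV (CountingFunctions.isCompl_subspaceU_subspaceV hK a₁)⟩
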